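/- Let $k\ge 3$ and $n\ge 1$ be integers. The $k$-ary $n$-cube $Q_n^k$ is the simple graph whose vertices are the $k^n$ words $u_{n-1}\cdots u_0$ with letters $u_i\in\{0,1,\dots,k-1\}$, two words $u$ and $v$ being adjacent if and only if there is a $j\in\{0,\dots,n-1\}$ with $u_j\equiv v_j\pm 1\pmod k$ and $u_i=v_i$ for all $i\neq j$. For a finite graph $G$ and a set $S\subseteq V(G)$ with $|S|\ge 2$, let $\kappa_G(S)$ be the maximum number $r$ of pairwise edge-disjoint trees $T_1,\dots,T_r$ in $G$, each containing $S$, such that $V(T_i)\cap V(T_j)=S$ for all $i\neq j$; and for $2\le m\le |V(G)|$ let $\kappa_m(G)=\min\{\kappa_G(S) : S\subseteq V(G),\ |S|=m\}$ be the generalized $m$-connectivity of $G$. Then $$\kappa_3(Q_n^k)=2n-1 .$$ -/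

import Mathlib

/-- The `k`-ary `n`-cube `Q_n^k` (for `2 ≤ k`, `1 ≤ n`). Its vertices are the words of length `n`
over `{0, …, k-1}`, the letters being read as residues modulo `k`. Two vertices are adjacent iff
for some position `j` their `j`-th letters differ by `±1` modulo `k` and all their other letters
agree. The clause `u ≠ v` is automatic for `2 ≤ k`. -/
def kAryCube (k n : ℕ) : SimpleGraph (Fin n → ZMod k) where
  Adj u v := u ≠ v ∧ ∃ j : Fin n, (u j = v j + 1 ∨ u j = v j - 1) ∧ ∀ i : Fin n, i ≠ j → u i = v i
  symm := ⟨by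
    rintro u v ⟨hne, j, h, hi⟩
    refine ⟨hne.symm, j, ?_, fun i hij => (hi i hij).symm⟩
    rcases h with h | h
    · exact Or.inr (by rw [h, add_sub_cancel_right])
    · exact Or.inl (by rw [h, sub_add_cancel])⟩
  loopless := ⟨fun _ h => h.1 rfl⟩

namespace SimpleGraph

/-- `T 0, …, T (r-1)` are internally disjoint trees of `G` connecting `S`: each `T i` is a subgraph
of `G` which is a tree and contains `S`, and any two of them have no edge in common and have
exactly the vertices of `S` in common. -/
structure IsInternallyDisjointTrees {V : Type*} (G : SimpleGraph V) (S : Finset V) {r : ℕ}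
    (T : Fin r → G.Subgraph) : Prop where
  isTree : ∀ i, (T i).coe.IsTree
  subset_verts : ∀ i, (S : Set V) ⊆ (T i).verts
  edge_disjoint : ∀ i j, i ≠ j → Disjoint (T i).edgeSet (T j).edgeSet
  inter_verts : ∀ i j, i ≠ j → (T i).verts ∩ (T j).verts = (S : Set V)

/-- `κ_G(S)`: the maximum number of internally disjoint trees of `G` connecting `S`
(a natural number if `G` is finite and `S` has at least two elements). -/
noncomputable def treeConnectivity {V : Type*} (G : SimpleGraph V) (S : Finset V) : ℕ∞ :=
  ⨆ r : {r : ℕ // ∃ T : Fin r → G.Subgraph, G.IsInternallyDisjointTrees S T}, ((r : ℕ) : ℕ∞)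

/-- The generalized `m`-connectivity `κ_m(G)` (for `2 ≤ m ≤ |V(G)|`): the minimum of `κ_G(S)` over
all sets `S` of exactly `m` vertices of `G`. -/
noncomputable def generalizedConnectivity {V : Type*} (G : SimpleGraph V) (m : ℕ) : ℕ∞ :=
  ⨅ S : {S : Finset V // S.card = m}, G.treeConnectivity S

end SimpleGraph

/-!
The `k`-ary cube of dimension `n` is `2n`-regular. If `x` and `y` are adjacent and `2n` internally
disjoint trees connected `x`, `y` and a third vertex, then each tree would use exactly one edge at
`x` and one at `y`, so the tree with the edge `xy` would have no further edge; hence at most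
`2n - 1` trees are possible (`treeConnectivity_le_of_adj`).

For the converse it is convenient to work with packings: families of edge-disjoint subgraphs that
join the given vertices and meet only in them; spanning trees of suitable components are then the
required trees (`HasPacking.le_treeConnectivity`). Separating one letter writes the cube of
dimension `n + 1` as the Cartesian product of a cycle and the cube `Q` of dimension `n`, that is,
as a cyclic arrangement of layers that are copies of `Q`. For `n = 0` a single path suffices. For
`n ≥ 1`, three vertices are placed in this product in one of three ways.

* They agree in some coordinate. With respect to it they lie in one layer, where induction gives
  `2n - 1` subgraphs, and the two neighbouring layers give one more each (`HasPacking.boxProd_row`).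
* Some coordinate takes exactly two values on them. Then two of them are joined by `2n` internally
  disjoint paths in their layer, and these paths are linked along columns to a fan from the third
  vertex; the layers on the other side of the cycle give one more subgraph
  (`hasPacking_boxProd_of_two_in_row`).
* All coordinates are pairwise distinct on them. Then `2n + 1` columns are chosen, including those
  of the three vertices, and linked by one fan in each of the three layers
  (`hasPacking_boxProd_of_distinct`).

The fans and paths exist because `Q` is `2n`-connected (`vertexConn_kAryCube`, by induction on the
dimension). The fan lemma `VertexConn.exists_fan` is deduced from Hall's marriage theorem: for a
set `A` of at most `2n` vertices not containing `x` there is an injective map `τ` from the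
vertices outside the closed neighbourhood of `x` to those outside `A ∪ {x}` that moves each vertex
by at most one edge, and iterating `τ` from the elements of `A` traces disjoint paths to the
neighbours of `x`.
-/

namespace SimpleGraph

/-! ### Packings of connecting subgraphs -/

section Packing

variable {V V' ι : Type*} {G : SimpleGraph V} {S : Set V}

/-- A family of spanning subgraphs `K i` of `G`, each of which joins all vertices of `S`, no two
of which share an edge, and no two of which share a non-isolated vertex outside `S`. Passing to a
spanning tree of the component of `K i` containing `S` yields internally disjoint trees. -/
structure IsPacking (G : SimpleGraph V) (S : Set V) (K : ι → SimpleGraph V) : Prop where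
  le : ∀ i, K i ≤ G
  reachable : ∀ i, ∀ a ∈ S, ∀ b ∈ S, (K i).Reachable a b
  inter_support : ∀ i j, i ≠ j → ∀ a, a ∈ (K i).support → a ∈ (K j).support → a ∈ S
  not_adj : ∀ i j, i ≠ j → ∀ a b, (K i).Adj a b → ¬ (K j).Adj a b

/-- `G` has a packing of `r` subgraphs joining `S`. -/
def HasPacking (G : SimpleGraph V) (S : Set V) (r : ℕ) : Prop :=
  ∃ K : Fin r → SimpleGraph V, G.IsPacking S K

theorem IsPacking.hasPacking [Finite ι] {K : ι → SimpleGraph V} (h : G.IsPacking S K) {r : ℕ}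
    (hr : r ≤ Nat.card ι) : G.HasPacking S r := by
  have := Fintype.ofFinite ι
  rw [Nat.card_eq_fintype_card] at hr
  obtain ⟨f⟩ : Nonempty (Fin r ↪ ι) := Function.Embedding.nonempty_of_card_le (by simpa using hr)
  exact ⟨fun i => K (f i), fun i => h.le _, fun i => h.reachable _,
    fun i j hij => h.inter_support _ _ (f.injective.ne hij),
    fun i j hij => h.not_adj _ _ (f.injective.ne hij)⟩

theorem HasPacking.of_iso {G' : SimpleGraph V'} {r : ℕ} (e : G ≃g G')
    (h : G'.HasPacking (e '' S) r) : G.HasPacking S r := by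
  obtain ⟨K, hK⟩ := h
  have supp : ∀ i a, a ∈ ((K i).comap e).support → e a ∈ (K i).support := by
    rintro i a ⟨b, hb⟩
    exact ⟨e b, hb⟩
  refine ⟨fun i => (K i).comap e, fun i a b hab => ?_, fun i a ha b hb => ?_,
    fun i j hij a ha hb => ?_, fun i j hij a b ha hb => hK.not_adj i j hij _ _ ha hb⟩
  · exact e.map_adj_iff.1 (hK.le i hab)
  · have := hK.reachable i _ (Set.mem_image_of_mem e ha) _ (Set.mem_image_of_mem e hb)
    let f : K i →g (K i).comap e := ⟨e.symm, by intro x y hxy; simpa using hxy⟩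
    simpa [f] using this.map f
  · exact (e.injective.mem_set_image).1
      (hK.inter_support i j hij _ (supp _ _ ha) (supp _ _ hb))

theorem exists_isTree_subgraph {K : SimpleGraph V} (hK : K ≤ G) {x : V}
    (hS : ∀ s ∈ S, K.Reachable x s) :
    ∃ T : G.Subgraph, T.coe.IsTree ∧ S ⊆ T.verts ∧ (∀ a ∈ T.verts, K.Reachable x a) ∧
      ∀ a b, T.Adj a b → K.Adj a b := by
  set c := K.connectedComponentMk x
  obtain ⟨F, hF, hT⟩ := c.connected_toSimpleGraph.exists_isTree_le
  have key : ∀ a b, (∃ (ha : a ∈ c.supp) (hb : b ∈ c.supp), F.Adj ⟨a, ha⟩ ⟨b, hb⟩) →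
      K.Adj a b := by
    rintro a b ⟨ha, hb, h⟩
    exact hF h
  refine ⟨{ verts := c.supp
            Adj := fun a b => ∃ (ha : a ∈ c.supp) (hb : b ∈ c.supp), F.Adj ⟨a, ha⟩ ⟨b, hb⟩
            adj_sub := fun {a b} h => hK (key a b h)
            edge_vert := fun {a b} ⟨ha, _⟩ => ha
            symm := ⟨fun a b ⟨ha, hb, h⟩ => ⟨hb, ha, h.symm⟩⟩ }, ?_, ?_, ?_, key⟩
  · refine Eq.mpr (congrArg IsTree (a₂ := F) ?_) hT
    ext ⟨a, ha⟩ ⟨b, hb⟩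
    exact ⟨fun ⟨_, _, h⟩ => h, fun h => ⟨ha, hb, h⟩⟩
  · intro s hs
    exact (ConnectedComponent.sound (hS s hs)).symm
  · intro a ha
    exact (ConnectedComponent.exact ha).symm

theorem HasPacking.le_treeConnectivity {S : Finset V} {r : ℕ} (hS : S.Nonempty)
    (h : G.HasPacking S r) : (r : ℕ∞) ≤ G.treeConnectivity S := by
  obtain ⟨x, hx⟩ := hS
  obtain ⟨K, hK⟩ := h
  choose T hT hST hv hadj using fun i =>
    exists_isTree_subgraph (hK.le i) (fun s hs => hK.reachable i x hx s hs)
  refine le_iSup (fun r : {r : ℕ // ∃ T : Fin r → G.Subgraph,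
    G.IsInternallyDisjointTrees S T} => ((r : ℕ) : ℕ∞)) ⟨r, T, hT, hST, ?_, ?_⟩
  · intro i j hij
    rw [Set.disjoint_left]
    rintro ⟨a, b⟩ ha hb
    exact hK.not_adj i j hij a b (hadj i _ _ ha) (hadj j _ _ hb)
  · intro i j hij
    refine Set.Subset.antisymm ?_ (Set.subset_inter (hST i) (hST j))
    rintro a ⟨ha, hb⟩
    by_cases hax : a = x
    · exact hax ▸ hx
    · exact hK.inter_support i j hij a (mem_support_of_reachable hax (hv i a ha).symm)
        (mem_support_of_reachable hax (hv j a hb).symm)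

end Packing

/-! ### The upper bound -/

section UpperBound

variable {V : Type*} {G : SimpleGraph V}

theorem IsInternallyDisjointTrees.exists_adj {S : Finset V} {r : ℕ} {T : Fin r → G.Subgraph}
    (hT : G.IsInternallyDisjointTrees S T) {x y : V} (hx : x ∈ S) (hy : y ∈ S) (hxy : x ≠ y)
    (i : Fin r) : ∃ w, (T i).Adj x w := by
  have h : (T i).coe.Reachable ⟨x, hT.subset_verts i hx⟩ ⟨y, hT.subset_verts i hy⟩ :=
    (hT.isTree i).connected.preconnected _ _
  rw [reachable_iff_reflTransGen] at h
  obtain h | ⟨b, hb, -⟩ := h.cases_head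
  · exact absurd (congrArg Subtype.val h) hxy
  · exact ⟨b, hb⟩

/-- If there are as many trees as `x` has neighbours, then `x` is a leaf of each of them. -/
theorem IsInternallyDisjointTrees.unique_adj {S : Finset V} {r : ℕ} {T : Fin r → G.Subgraph}
    (hT : G.IsInternallyDisjointTrees S T) {x y : V} (hx : x ∈ S) (hy : y ∈ S) (hxy : x ≠ y)
    [Finite (G.neighborSet x)] (hr : Nat.card (G.neighborSet x) ≤ r) :
    ∃ f : Fin r → V, (∀ i, (T i).Adj x (f i)) ∧ (∀ i w, (T i).Adj x w → w = f i) ∧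
      ∀ w, G.Adj x w → ∃ i, f i = w := by
  choose f hf using fun i => hT.exists_adj hx hy hxy i
  have uniq : ∀ i j w, (T i).Adj x w → (T j).Adj x w → i = j := by
    intro i j w hi hj
    by_contra hij
    exact Set.disjoint_left.1 (hT.edge_disjoint i j hij) (show s(x, w) ∈ _ from hi) hj
  let g : Fin r → G.neighborSet x := fun i => ⟨f i, (T i).adj_sub (hf i)⟩
  have ginj : Function.Injective g := by
    intro i j hij
    have : f i = f j := congrArg Subtype.val hij
    exact uniq i j (f i) (hf i) (this ▸ hf j)
  have gsurj : Function.Surjective g := by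
    have hc := Nat.card_le_card_of_injective g ginj
    have := Fintype.ofFinite (G.neighborSet x)
    refine ((Fintype.bijective_iff_injective_and_card g).2 ⟨ginj, ?_⟩).2
    simp only [Nat.card_eq_fintype_card, Fintype.card_fin] at hr hc ⊢
    omega
  have fsurj : ∀ w, G.Adj x w → ∃ i, f i = w := fun w hw =>
    (gsurj ⟨w, hw⟩).imp fun i hi => congrArg Subtype.val hi
  refine ⟨f, hf, fun i w hw => ?_, fsurj⟩
  obtain ⟨j, rfl⟩ := fsurj w ((T i).adj_sub hw)
  rw [uniq i j _ hw (hf j)]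

/-- If `x` and `y` are adjacent and have degree at most `d`, then at most `d - 1` internally
disjoint trees connect `x`, `y` and a third vertex: among `d` such trees one would have the edge
`xy` as a component. -/
theorem treeConnectivity_le_of_adj [DecidableEq V] {x y z : V} (hxy : G.Adj x y) (hzx : z ≠ x)
    (hzy : z ≠ y) {d : ℕ} [Finite (G.neighborSet x)] [Finite (G.neighborSet y)]
    (hx : Nat.card (G.neighborSet x) ≤ d) (hy : Nat.card (G.neighborSet y) ≤ d) :
    G.treeConnectivity {x, y, z} ≤ ((d - 1 : ℕ) : ℕ∞) := by
  refine iSup_le ?_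
  rintro ⟨r, T, hT⟩
  by_contra hlt
  have hr : d ≤ r := by
    have : ¬ r ≤ d - 1 := fun h => hlt (by exact_mod_cast h)
    omega
  obtain ⟨f, hf, funiq, fsurj⟩ := hT.unique_adj (x := x) (y := y) (by simp) (by simp) hxy.ne
    (hx.trans hr)
  obtain ⟨g, hg, guniq, gsurj⟩ := hT.unique_adj (x := y) (y := x) (by simp) (by simp) hxy.ne'
    (hy.trans hr)
  obtain ⟨i, hi⟩ := fsurj y hxy
  have h1 : (T i).Adj x y := hi ▸ hf i
  have h2 : g i = x := (guniq i x h1.symm).symm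
  have hz : z ∈ (T i).verts := hT.subset_verts i (by simp)
  have hxv : x ∈ (T i).verts := hT.subset_verts i (by simp)
  have h : (T i).coe.Reachable ⟨x, hxv⟩ ⟨z, hz⟩ := (hT.isTree i).connected.preconnected _ _
  rw [reachable_iff_reflTransGen] at h
  have : ∀ b, Relation.ReflTransGen (T i).coe.Adj ⟨x, hxv⟩ b → b.1 = x ∨ b.1 = y := by
    intro b hb
    induction hb with
    | refl => exact Or.inl rfl
    | tail _ hbc ih =>
      rcases ih with ih | ih
      · exact Or.inr ((funiq i _ (ih ▸ hbc)).trans hi)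
      · exact Or.inl ((guniq i _ (ih ▸ hbc)).trans h2)
  exact (this _ h).elim hzx hzy

end UpperBound

/-! ### Vertex connectivity and fans -/

section Fans

variable {V : Type*} {G : SimpleGraph V} {m : ℕ}

/-- The edges of `G` with both ends in `W`, except those with both ends in `E`, as a graph on all
vertices of `G`. -/
def within (G : SimpleGraph V) (W E : Set V) : SimpleGraph V where
  Adj a b := G.Adj a b ∧ a ∈ W ∧ b ∈ W ∧ ¬ (a ∈ E ∧ b ∈ E)
  symm := ⟨fun _ _ ⟨h, ha, hb, hE⟩ => ⟨h.symm, hb, ha, fun h => hE h.symm⟩⟩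
  loopless := ⟨fun _ h => G.loopless.irrefl _ h.1⟩

theorem within_le (W E : Set V) : G.within W E ≤ G := fun _ _ h => h.1

/-- `G` is `m`-vertex-connected in the sense that deleting fewer than `m` vertices never leaves
two components. It is phrased through predicates: a predicate that is constant along the edges of
`G - F` is constant on `G - F`. Complete graphs satisfy this for every `m`. -/
def VertexConn (G : SimpleGraph V) (m : ℕ) : Prop :=
  ∀ F : Finset V, F.card < m → ∀ f : V → Prop,
    (∀ a b, a ∉ F → b ∉ F → G.Adj a b → f a → f b) → ∀ a b, a ∉ F → b ∉ F → f a → f b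

theorem VertexConn.preconnected (h : G.VertexConn m) (hm : 0 < m) : G.Preconnected := fun a b =>
  h ∅ (by simpa) (G.Reachable a) (fun _ _ _ _ hab hb => hb.trans hab.reachable) a b
    (by simp) (by simp) (Reachable.refl a)

theorem VertexConn.of_iso {V' : Type*} {G' : SimpleGraph V'} (e : G ≃g G')
    (h : G.VertexConn m) : G'.VertexConn m := by
  intro F hF f hf a b ha hb hfa
  have mem : ∀ v, v ∈ F.map e.symm.toEquiv.toEmbedding ↔ e v ∈ F := by
    intro v
    simp only [Finset.mem_map_equiv]
    rfl
  have := h (F.map e.symm.toEquiv.toEmbedding) (by simpa using hF) (fun v => f (e v))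
    (fun u v hu hv huv => hf _ _ ((mem u).not.1 hu) ((mem v).not.1 hv) (e.map_adj_iff.2 huv))
    (e.symm a) (e.symm b) (by rw [mem]; simpa using ha) (by rw [mem]; simpa using hb)
  simpa [hfa] using this

/-- Hall's condition for the closed neighbourhoods of the vertices outside `N[x]`, with the targets
in `A` removed, follows from connectivity: a violating set `X` would be separated from `x` by
fewer than `#A` vertices. -/
theorem VertexConn.exists_injective [Fintype V] [DecidableEq V] (h : G.VertexConn m) {x : V}
    {A : Finset V} (hA : A.card ≤ m) (hx : x ∉ A) :
    ∃ τ : {u // u ≠ x ∧ ¬ G.Adj x u} → V, Function.Injective τ ∧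
      ∀ u, (τ u = u ∨ G.Adj u (τ u)) ∧ τ u ≠ x ∧ τ u ∉ A := by
  classical
  let t : {u // u ≠ x ∧ ¬ G.Adj x u} → Finset V := fun u =>
    Finset.univ.filter fun w => (w = u ∨ G.Adj u w) ∧ w ≠ x ∧ w ∉ A
  obtain ⟨τ, hτ, hmem⟩ := (Finset.all_card_le_biUnion_card_iff_exists_injective t).1 (by
    intro s
    by_contra! hlt
    set X : Finset V := s.map (Function.Embedding.subtype _) with hX
    have hXs : X.card = s.card := Finset.card_map _
    set B := s.biUnion t with hB
    have memX : ∀ a ∈ X, a ≠ x ∧ ¬ G.Adj x a := by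
      intro a ha
      obtain ⟨u, -, rfl⟩ := Finset.mem_map.1 ha
      exact u.2
    have memB : ∀ a ∈ X, ∀ w, (w = a ∨ G.Adj a w) → w ≠ x → w ∉ A → w ∈ B := by
      intro a ha w hw hwx hwA
      obtain ⟨u, hu, rfl⟩ := Finset.mem_map.1 ha
      exact Finset.mem_biUnion.2 ⟨u, hu, by simpa [t] using ⟨hw, hwx, hwA⟩⟩
    have hBX : X \ A ⊆ B ∩ X := by
      intro a ha
      obtain ⟨ha, haA⟩ := Finset.mem_sdiff.1 ha
      exact Finset.mem_inter.2 ⟨memB a ha a (Or.inl rfl) (memX a ha).1 haA, ha⟩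
    have c1 := Finset.card_le_card hBX
    have c2 := Finset.card_sdiff_add_card_inter X A
    have c3 := Finset.card_sdiff_add_card_inter B X
    have c4 := Finset.card_sdiff_add_card_inter A X
    have c5 := Finset.card_union_le (B \ X) (A \ X)
    rw [Finset.inter_comm A X] at c4
    obtain ⟨a, ha⟩ : X.Nonempty := by
      rw [← Finset.card_pos]; omega
    have := h (B \ X ∪ A \ X) (by omega) (· ∈ X) (by
      intro p q _ hq hpq hp
      by_contra hqX
      refine hq ?_
      by_cases hqA : q ∈ A
      · exact Finset.mem_union_right _ (Finset.mem_sdiff.2 ⟨hqA, hqX⟩)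
      · refine Finset.mem_union_left _ (Finset.mem_sdiff.2 ⟨memB p hp q (Or.inr hpq) ?_ hqA, hqX⟩)
        rintro rfl
        exact (memX p hp).2 hpq.symm) a x (by simp [ha]) (by
      have : x ∉ B := by simp [hB, t]
      simp [hx, this]) ha
    exact (memX x this).1 rfl)
  exact ⟨τ, hτ, fun u => by simpa [t] using hmem u⟩

theorem VertexConn.exists_fan_of_notMem [Finite V] (h : G.VertexConn m) {x : V}
    {A : Finset V} (hA : A.card ≤ m) (hx : x ∉ A) :
    ∃ D : V → Set V, (∀ v ∈ A, v ∈ D v ∧ (G.within (D v) ∅).Reachable x v) ∧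
      ∀ v ∈ A, ∀ w ∈ A, v ≠ w → ∀ a ∈ D v, a ∈ D w → a = x := by
  classical
  have := Fintype.ofFinite V
  obtain ⟨τ, hinj, hτ⟩ := h.exists_injective hA hx
  -- `C v` is the chain `v, τ v, τ (τ v), …`, which stops in the neighbourhood of `x`
  let R : V → V → Prop := fun u w => ∃ hu : u ≠ x ∧ ¬ G.Adj x u, τ ⟨u, hu⟩ = w
  let C : V → V → Prop := Relation.ReflTransGen R
  have Rinj : ∀ u u' w, R u w → R u' w → u = u' := by
    rintro u u' w ⟨hu, rfl⟩ ⟨hu', h'⟩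
    exact (congrArg Subtype.val (hinj h')).symm
  have RA : ∀ u w, R u w → w ∉ A := by
    rintro u w ⟨hu, rfl⟩
    exact (hτ _).2.2
  have Cne : ∀ v ∈ A, ∀ w, C v w → w ≠ x := by
    intro v hv w hw
    obtain rfl | ⟨u, -, hu, rfl⟩ := hw.cases_tail
    · exact fun h => hx (h ▸ hv)
    · exact (hτ _).2.1
  have Cdisj : ∀ v ∈ A, ∀ w ∈ A, ∀ a, C v a → C w a → v = w := by
    intro v hv w hw a hva
    induction hva with
    | refl =>
      intro hwv
      obtain h | ⟨u, -, hu⟩ := hwv.cases_tail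
      · exact h
      · exact absurd hv (RA _ _ hu)
    | tail _ hbc ih =>
      intro hwc
      obtain rfl | ⟨u, hu, hu'⟩ := hwc.cases_tail
      · exact absurd hw (RA _ _ hbc)
      · exact ih (Rinj _ _ _ hu' hbc ▸ hu)
  have Cend : ∀ v ∈ A, ∃ w, C v w ∧ G.Adj x w := by
    intro v hv
    by_contra! hno
    have hP : ∀ w : {w // C v w}, w.1 ≠ x ∧ ¬ G.Adj x w.1 := fun w =>
      ⟨Cne v hv _ w.2, hno _ w.2⟩
    -- otherwise `τ` maps the finite chain injectively to itself, missing `v`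
    let g : {w // C v w} → {w // C v w} := fun w =>
      ⟨τ ⟨w.1, hP w⟩, w.2.tail ⟨hP w, rfl⟩⟩
    have ginj : Function.Injective g := by
      intro a b hab
      have := hinj (congrArg Subtype.val hab)
      exact Subtype.ext (Subtype.mk.inj this)
    obtain ⟨a, ha⟩ := Finite.surjective_of_injective ginj ⟨v, Relation.ReflTransGen.refl⟩
    exact RA a.1 v ⟨hP a, congrArg Subtype.val ha⟩ hv
  refine ⟨fun v => insert x {w | C v w}, fun v hv =>
    ⟨Or.inr Relation.ReflTransGen.refl, ?_⟩, ?_⟩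
  · obtain ⟨w, hw, hxw⟩ := Cend v hv
    refine Reachable.trans (v := w) (Adj.reachable ⟨hxw, Or.inl rfl, Or.inr hw, by simp⟩) ?_
    refine Reachable.symm ?_
    clear hxw
    induction hw with
    | refl => exact Reachable.refl _
    | @tail b c hvb hbc ih =>
      refine ih.trans ?_
      obtain ⟨hb, rfl⟩ := id hbc
      rcases (hτ ⟨b, hb⟩).1 with h | h
      · rw [h]
      · exact Adj.reachable ⟨h, Or.inr hvb, Or.inr (hvb.tail hbc), by simp⟩
  · rintro v hv w hw hne a (rfl | ha) (h | hb)
    · rfl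
    · rfl
    · exact h
    · exact absurd (Cdisj v hv w hw a ha hb) hne

/-- The fan lemma, with the fans given by their vertex sets. If `x ∈ A`, then `x` is joined to
itself by a trivial path. -/
theorem VertexConn.exists_fan [Finite V] [DecidableEq V] (h : G.VertexConn m) (x : V)
    {A : Finset V} (hA : (A.erase x).card ≤ m) :
    ∃ D : V → Set V, (∀ v ∈ A, v ∈ D v ∧ (G.within (D v) ∅).Reachable x v) ∧
      ∀ v ∈ A, ∀ w ∈ A, v ≠ w → ∀ a ∈ D v, a ∈ D w → a = x := by
  obtain ⟨D, hD, hdisj⟩ := h.exists_fan_of_notMem hA (Finset.notMem_erase x A)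
  refine ⟨fun v => if v = x then {x} else D v, ?_, ?_⟩
  · intro v hv
    by_cases hvx : v = x
    · subst hvx
      simp
    · simpa [hvx] using hD v (Finset.mem_erase.2 ⟨hvx, hv⟩)
  · intro v hv w hw hne a ha hb
    by_cases hvx : v = x
    · simpa [hvx] using ha
    · by_cases hwx : w = x
      · simpa [hwx] using hb
      · exact hdisj v (Finset.mem_erase.2 ⟨hvx, hv⟩) w (Finset.mem_erase.2 ⟨hwx, hw⟩) hne a
          (by simpa [hvx] using ha) (by simpa [hwx] using hb)

/-- A vertex `y` whose only possible neighbour in `D` is `v` is not needed to reach `v`. -/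
theorem reachable_within_diff_singleton {D : Set V} {x y v : V}
    (h : (G.within D ∅).Reachable x v) (hx : x ≠ y)
    (hD : ∀ u ∈ D, G.Adj y u → u = v) : (G.within (D \ {y}) ∅).Reachable x v := by
  rw [reachable_iff_reflTransGen] at h
  have : ∀ w, Relation.ReflTransGen (G.within D ∅).Adj x w →
      (G.within (D \ {y}) ∅).Reachable x v ∨
        w ≠ y ∧ (G.within (D \ {y}) ∅).Reachable x w := by
    intro w hw
    induction hw with
    | refl => exact Or.inr ⟨hx, Reachable.refl _⟩
    | @tail b c _ hbc ih =>
      rcases ih with ih | ⟨hb, ih⟩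
      · exact Or.inl ih
      · by_cases hc : c = y
        · exact Or.inl (hD b hbc.2.1 (hc ▸ hbc.1.symm) ▸ ih)
        · exact Or.inr ⟨hc, ih.trans
            (Adj.reachable ⟨hbc.1, ⟨hbc.2.1, hb⟩, ⟨hbc.2.2.1, hc⟩, by simp⟩)⟩
  exact (this v h).elim id And.right

/-- Internally disjoint paths from `x` to `y`, one through each neighbour `v` of `y`; `D v` is the
vertex set of the part from `x` to `v`. -/
theorem VertexConn.exists_paths [Finite V] (h : G.VertexConn m) {x y : V} (hxy : x ≠ y)
    {N : Finset V} (hN : ∀ v, v ∈ N ↔ G.Adj y v) (hm : N.card ≤ m) :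
    ∃ D : V → Set V, (∀ v ∈ N, v ∈ D v ∧ y ∉ D v ∧ (G.within (D v) ∅).Reachable x v) ∧
      ∀ v ∈ N, ∀ w ∈ N, v ≠ w → ∀ a ∈ D v, a ∈ D w → a = x := by
  classical
  have hy : y ∉ N := fun h => G.loopless.irrefl _ ((hN y).1 h)
  by_cases hx : x ∈ N
  · -- the edge `xy` is one of the paths, so the other neighbours of `y` are joined to `x` by a fan
    -- that has `y` as a further target and hence avoids it elsewhere
    obtain ⟨D, hD, hdisj⟩ := h.exists_fan x (A := insert y N) (by
      rw [Finset.erase_insert_of_ne hxy.symm, Finset.card_insert_of_notMem (by simp [hy]),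
        Finset.card_erase_add_one hx]
      exact hm)
    refine ⟨D, ?_, ?_⟩
    · intro v hv
      have hvy : v ≠ y := fun h => hy (h ▸ hv)
      have hDv := hD v (Finset.mem_insert_of_mem hv)
      have : y ∉ D v := fun hyv => hxy.symm (hdisj v (Finset.mem_insert_of_mem hv) y
        (Finset.mem_insert_self _ _) hvy y hyv (hD y (Finset.mem_insert_self _ _)).1)
      exact ⟨hDv.1, this, hDv.2⟩
    · intro v hv w hw hne a ha hb
      exact hdisj v (Finset.mem_insert_of_mem hv) w (Finset.mem_insert_of_mem hw) hne a ha hb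
  · obtain ⟨D, hD, hdisj⟩ := h.exists_fan x (A := N) (by rwa [Finset.erase_eq_of_notMem hx])
    refine ⟨fun v => D v \ {y}, ?_, ?_⟩
    · intro v hv
      have hvy : v ≠ y := fun h => hy (h ▸ hv)
      refine ⟨⟨(hD v hv).1, hvy⟩, fun h => h.2 rfl,
        reachable_within_diff_singleton (hD v hv).2 hxy ?_⟩
      intro u hu hyu
      have huN := (hN u).2 hyu
      by_contra huv
      exact hx (hdisj u huN v hv huv u (hD u huN).1 hu ▸ huN)
    · intro v hv w hw hne a ha hb
      exact hdisj v hv w hw hne a ha.1 hb.1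

end Fans

/-! ### Connectivity of Cartesian products with a cycle -/

section Product

variable {C V : Type*} {Z : SimpleGraph C} {Q : SimpleGraph V} {m : ℕ}

/-- If fewer than `m + 2` vertices are deleted, then at most one layer loses `m` or more of them.
The other layers stay connected internally and, since a layer is large, to their neighbouring
layers; a vertex of the exceptional layer has two neighbours outside that layer, not both of
which are deleted. -/
theorem VertexConn.boxProd [Finite V] (hZ : Z.VertexConn 2)
    (hdeg : ∀ s, ∃ t t', t ≠ t' ∧ Z.Adj s t ∧ Z.Adj s t') (hQ : Q.VertexConn m) (hm : 2 ≤ m)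
    (hcard : m < Nat.card V) (hcard' : m = 2 ∨ m + 2 ≤ Nat.card V) :
    (Z □ Q).VertexConn (m + 2) := by
  classical
  have := Fintype.ofFinite V
  rw [Nat.card_eq_fintype_card] at hcard hcard'
  intro F hF f hf
  let L : C → Finset V := fun s => Finset.univ.filter fun p => (s, p) ∈ F
  have memL : ∀ s p, p ∈ L s ↔ (s, p) ∈ F := fun s p => by simp [L]
  have sum_le : ∀ s t, s ≠ t → (L s).card + (L t).card ≤ F.card := by
    intro s t hst
    have hd : Disjoint ((L s).map (Function.Embedding.sectR s V))
        ((L t).map (Function.Embedding.sectR t V)) := by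
      simp only [Finset.disjoint_left, Finset.mem_map, Function.Embedding.sectR_apply]
      rintro _ ⟨p, -, rfl⟩ ⟨q, -, h⟩
      exact hst (congrArg Prod.fst h).symm
    rw [← Finset.card_map (Function.Embedding.sectR s V),
      ← Finset.card_map (Function.Embedding.sectR t V), ← Finset.card_union_of_disjoint hd]
    refine Finset.card_le_card fun a ha => ?_
    simp only [Finset.mem_union, Finset.mem_map, Function.Embedding.sectR_apply, memL] at ha
    rcases ha with ⟨p, hp, rfl⟩ | ⟨p, hp, rfl⟩ <;> exact hp
  let Good : C → Prop := fun s => (L s).card < m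
  have bad_unique : ∀ s t, ¬ Good s → ¬ Good t → s = t := by
    intro s t hs ht
    by_contra hst
    have := sum_le s t hst
    simp only [Good] at hs ht
    omega
  have layer : ∀ s, Good s → ∀ p q, (s, p) ∉ F → (s, q) ∉ F → f (s, p) → f (s, q) := by
    intro s hs p q hp hq
    refine hQ (L s) hs (fun p => f (s, p)) (fun a b ha hb hab => ?_) p q
      (by rwa [memL]) (by rwa [memL])
    exact hf _ _ (by rwa [memL] at ha) (by rwa [memL] at hb) (boxProd_adj_right.2 hab)
  have free : ∀ s t, Good s → Good t → (s = t ∨ Z.Adj s t) →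
      ∃ p, (s, p) ∉ F ∧ (t, p) ∉ F := by
    intro s t hs ht hst
    have hlt : (L s ∪ L t).card < Fintype.card V := by
      rcases hst with rfl | hst
      · rw [Finset.union_self]
        exact hs.trans hcard
      · have h1 := sum_le s t hst.ne
        have h2 := Finset.card_union_le (L s) (L t)
        simp only [Good] at hs ht
        omega
    obtain ⟨p, -, hp⟩ := Finset.exists_mem_notMem_of_card_lt_card
      (s := L s ∪ L t) (t := Finset.univ) (by rwa [Finset.card_univ])
    rw [Finset.mem_union, memL, memL, not_or] at hp
    exact ⟨p, hp⟩
  have layer' : ∀ s t, Good s → Good t → ∀ p q, (s, p) ∉ F → (t, q) ∉ F →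
      f (s, p) → f (t, q) := by
    intro s t hs ht p q hp hq hfp
    -- the exceptional layers form a set of at most one vertex of the cycle
    have hbad : ∃ B : Finset C, B.card < 2 ∧ ∀ u, u ∉ B ↔ Good u := by
      by_cases hb : ∃ b, ¬ Good b
      · obtain ⟨b, hb⟩ := hb
        refine ⟨{b}, by simp, fun u => ?_⟩
        rw [Finset.mem_singleton]
        exact ⟨fun h => not_not.1 fun hu => h (bad_unique u b hu hb), fun h hub => hb (hub ▸ h)⟩
      · push Not at hb
        exact ⟨∅, by simp, fun u => by simpa using hb u⟩
    obtain ⟨B, hB, hBG⟩ := hbad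
    have := hZ B hB (fun u => ∃ p, (u, p) ∉ F ∧ f (u, p)) (by
      rintro a b ha hb hab ⟨p, hp, hfp⟩
      obtain ⟨r, hra, hrb⟩ := free a b ((hBG a).1 ha) ((hBG b).1 hb) (Or.inr hab)
      exact ⟨r, hrb, hf _ _ hra hrb (boxProd_adj_left.2 hab)
        (layer a ((hBG a).1 ha) p r hp hra hfp)⟩) s t ((hBG s).2 hs) ((hBG t).2 ht) ⟨p, hp, hfp⟩
    obtain ⟨r, hr, hfr⟩ := this
    exact layer t ht r q hr hq hfr
  have escape : ∀ s p, (s, p) ∉ F → ∃ t, Good t ∧ (t, p) ∉ F ∧ (s = t ∨ Z.Adj s t) := by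
    intro s p hp
    by_cases hs : Good s
    · exact ⟨s, hs, hp, Or.inl rfl⟩
    obtain ⟨t, t', hne, ht, ht'⟩ := hdeg s
    have good : ∀ u, Z.Adj s u → Good u := fun u hu =>
      not_not.1 fun h => hu.ne (bad_unique s u hs h)
    by_cases htF : (t, p) ∈ F
    · refine ⟨t', good t' ht', fun htF' => ?_, Or.inr ht'⟩
      have hsub : insert (t, p) (insert (t', p) ((L s).map (Function.Embedding.sectR s V))) ⊆ F := by
        intro a ha
        simp only [Finset.mem_insert, Finset.mem_map, Function.Embedding.sectR_apply, memL] at ha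
        rcases ha with rfl | rfl | ⟨q, hq, rfl⟩
        · exact htF
        · exact htF'
        · exact hq
      have := Finset.card_le_card hsub
      rw [Finset.card_insert_of_notMem (by simp [hne, ht.ne]),
        Finset.card_insert_of_notMem (by simp [ht'.ne]), Finset.card_map] at this
      simp only [Good] at hs
      omega
    · exact ⟨t, good t ht, htF, Or.inr ht⟩
  rintro ⟨s, p⟩ ⟨t, q⟩ hp hq hfp
  obtain ⟨s', hs', hps', hss'⟩ := escape s p hp
  obtain ⟨t', ht', hqt', htt'⟩ := escape t q hq
  have h1 : f (s', p) := by
    rcases hss' with rfl | h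
    · exact hfp
    · exact hf _ _ hp hps' (boxProd_adj_left.2 h) hfp
  have h2 := layer' s' t' hs' ht' p q hps' hqt' h1
  rcases htt' with rfl | h
  · exact h2
  · exact hf _ _ hqt' hq (boxProd_adj_left.2 h.symm) h2

theorem card_neighborSet_boxProd [Finite C] [Finite V] (a : C × V) :
    Nat.card ((Z □ Q).neighborSet a) =
      Nat.card (Z.neighborSet a.1) + Nat.card (Q.neighborSet a.2) := by
  classical
  have := Fintype.ofFinite C
  have := Fintype.ofFinite V
  simp only [Nat.card_eq_fintype_card, card_neighborSet_eq_degree]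
  convert degree_boxProd a

/-! ### Packings in Cartesian products -/

theorem within.reachable_row {D : Set V} {W E : Set (C × V)} {s : C} {p q : V}
    (h : (Q.within D ∅).Reachable p q) (hD : ∀ a ∈ D, (s, a) ∈ W)
    (hE : ∀ a ∈ D, ∀ b ∈ D, Q.Adj a b → (s, a) ∈ E → (s, b) ∉ E) :
    ((Z □ Q).within W E).Reachable (s, p) (s, q) :=
  h.map (⟨fun a => (s, a), fun ⟨hab, ha, hb, _⟩ => ⟨boxProd_adj_right.2 hab, hD _ ha, hD _ hb,
    fun h => hE _ ha _ hb hab h.1 h.2⟩⟩ : Q.within D ∅ →g (Z □ Q).within W E)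

theorem within.reachable_column {A : Set C} {W E : Set (C × V)} {s t : C} {p : V}
    (h : (Z.within A ∅).Reachable s t) (hA : ∀ a ∈ A, (a, p) ∈ W)
    (hE : ∀ a ∈ A, ∀ b ∈ A, Z.Adj a b → (a, p) ∈ E → (b, p) ∉ E) :
    ((Z □ Q).within W E).Reachable (s, p) (t, p) :=
  h.map (⟨fun a => (a, p), fun ⟨hab, ha, hb, _⟩ => ⟨boxProd_adj_left.2 hab, hA _ ha, hA _ hb,
    fun h => hE _ ha _ hb hab h.1 h.2⟩⟩ : Z.within A ∅ →g (Z □ Q).within W E)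

theorem within_univ : Q.within Set.univ ∅ = Q := by
  ext a b
  simp [within]

theorem isPacking_within {V ι : Type*} {G : SimpleGraph V} {S : Set V} {W E : ι → Set V} {x : V}
    (hr : ∀ i, ∀ a ∈ S, (G.within (W i) (E i)).Reachable x a)
    (hW : ∀ i j, i ≠ j → ∀ a ∈ W i, a ∈ W j → a ∈ S)
    (hE : ∀ i j, i ≠ j → ∀ a ∈ S, ∀ b ∈ S, G.Adj a b → (a ∈ E i ∧ b ∈ E i) ∨ (a ∈ E j ∧ b ∈ E j)) :
    G.IsPacking S fun i => G.within (W i) (E i) where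
  le i := within_le _ _
  reachable i a ha b hb := (hr i a ha).symm.trans (hr i b hb)
  inter_support i j hij a := by
    rintro ⟨b, hb⟩ ⟨c, hc⟩
    exact hW i j hij a hb.2.1 hc.2.1
  not_adj i j hij a b ha hb := by
    rcases hE i j hij a (hW i j hij a ha.2.1 hb.2.1) b (hW i j hij b ha.2.2.1 hb.2.2.1) ha.1 with
      h | h
    · exact ha.2.2.2 h
    · exact hb.2.2.2 h

/-- A packing in a layer extends to the product: each neighbouring layer provides a further
connected subgraph. -/
theorem HasPacking.boxProd_row [Finite C] {s : C} {S : Set V} {r : ℕ} (hQ : Q.Preconnected)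
    (h : Q.HasPacking S r) :
    (Z □ Q).HasPacking (Prod.mk s '' S) (r + Nat.card (Z.neighborSet s)) := by
  obtain ⟨K, hK⟩ := h
  let E : Set (C × V) := {a | a.1 = s}
  let W : C → Set (C × V) := fun t => {a | a.1 = t ∨ a ∈ Prod.mk s '' S}
  let f : V ↪ C × V := Function.Embedding.sectR s V
  let K' : Fin r ⊕ Z.neighborSet s → SimpleGraph (C × V) :=
    Sum.elim (fun i => (K i).map f) fun t => (Z □ Q).within (W t) E
  have suppl : ∀ i a, a ∈ ((K i).map f).support → ∃ p, a = (s, p) ∧ p ∈ (K i).support := by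
    rintro i a ⟨b, hb⟩
    obtain ⟨u, v, huv, rfl, rfl⟩ := (map_adj _ _ _ _).1 hb
    exact ⟨u, rfl, v, huv⟩
  have suppr : ∀ t a, a ∈ ((Z □ Q).within (W t) E).support → a ∈ W t := by
    rintro t a ⟨b, hb⟩
    exact hb.2.1
  have adjl : ∀ i a b, ((K i).map f).Adj a b → ∃ p q, (K i).Adj p q ∧ (s, p) = a ∧ (s, q) = b :=
    fun i a b h => (map_adj _ _ _ _).1 h
  have hK' : (Z □ Q).IsPacking (Prod.mk s '' S) K' := by
    refine ⟨?_, ?_, ?_, ?_⟩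
    · rintro (i | t)
      · intro a b hab
        obtain ⟨p, q, hpq, rfl, rfl⟩ := adjl i a b hab
        exact boxProd_adj_right.2 (hK.le i hpq)
      · exact within_le _ _
    · rintro (i | ⟨t, ht⟩) _ ⟨p, hp, rfl⟩ _ ⟨q, hq, rfl⟩
      · exact (hK.reachable i p hp q hq).map (Embedding.map f (K i)).toHom
      · have ht' : t ≠ s := (Adj.ne ht).symm
        have vert : ∀ u ∈ S, ((Z □ Q).within (W t) E).Reachable (s, u) (t, u) := fun u hu =>
          Adj.reachable ⟨boxProd_adj_left.2 ht, Or.inr ⟨u, hu, rfl⟩, Or.inl rfl, fun h => ht' h.2⟩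
        refine (vert p hp).trans (Reachable.trans ?_ (vert q hq).symm)
        refine within.reachable_row (D := Set.univ) (by rw [within_univ]; exact hQ p q)
          (fun _ _ => Or.inl rfl) (fun _ _ _ _ _ h => absurd h ht')
    · rintro (i | ⟨t, ht⟩) (j | ⟨t', ht'⟩) hij a ha hb
      · obtain ⟨p, rfl, hp⟩ := suppl i a ha
        obtain ⟨q, hq, hq'⟩ := suppl j _ hb
        obtain rfl : p = q := congrArg Prod.snd hq
        exact ⟨p, hK.inter_support i j (fun h => hij (h ▸ rfl)) p hp hq', rfl⟩
      · obtain ⟨p, rfl, hp⟩ := suppl i a ha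
        exact (suppr _ _ hb).resolve_left (Adj.ne ht')
      · obtain ⟨p, rfl, hp⟩ := suppl j a hb
        exact (suppr _ _ ha).resolve_left (Adj.ne ht)
      · rcases suppr _ _ ha with h | h
        · refine (suppr _ _ hb).resolve_left fun h' => hij ?_
          have : t = t' := h.symm.trans h'
          subst this
          rfl
        · exact h
    · rintro (i | ⟨t, ht⟩) (j | ⟨t', ht'⟩) hij a b ha hb
      · obtain ⟨p, q, hpq, rfl, rfl⟩ := adjl i a b ha
        obtain ⟨p', q', hpq', h1, h2⟩ := adjl j _ _ hb
        obtain rfl : p' = p := congrArg Prod.snd h1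
        obtain rfl : q' = q := congrArg Prod.snd h2
        exact hK.not_adj i j (fun h => hij (h ▸ rfl)) _ _ hpq hpq'
      · obtain ⟨p, q, hpq, rfl, rfl⟩ := adjl i a b ha
        exact hb.2.2.2 ⟨rfl, rfl⟩
      · obtain ⟨p, q, hpq, rfl, rfl⟩ := adjl j a b hb
        exact ha.2.2.2 ⟨rfl, rfl⟩
      · have mem : ∀ c, c ∈ W t → c ∈ W t' → c ∈ E := by
          rintro c (h | ⟨p, -, rfl⟩) (h' | h')
          · exact absurd (by have : t = t' := h.symm.trans h'
                             subst this; rfl) hij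
          · obtain ⟨p, -, rfl⟩ := h'
            rfl
          · rfl
          · rfl
        exact ha.2.2.2 ⟨mem a ha.2.1 hb.2.1, mem b ha.2.2.1 hb.2.2.1⟩
  exact hK'.hasPacking (by simp [Nat.card_sum])

end Product

section Distribution

variable {C V : Type*} {Z : SimpleGraph C} {Q : SimpleGraph V} {m : ℕ}

/-- `A`, `B`, `D` are the interiors of the three arcs into which the vertices `a`, `b`, `c` of a
cycle divide it, joining `a` to `b`, `b` to `c` and `c` to `a`; only the properties of these sets
that are needed to route paths along them are recorded. -/
structure IsArcs (Z : SimpleGraph C) (a b c : C) (A B D : Set C) : Prop where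
  disjoint : ∀ s, (s ∈ A → s ∉ B) ∧ (s ∈ B → s ∉ D) ∧ (s ∈ A → s ∉ D)
  ne : ∀ s, s ∈ A ∨ s ∈ B ∨ s ∈ D → s ≠ a ∧ s ≠ b ∧ s ≠ c
  reachable_left : (Z.within (insert a (insert b A)) ∅).Reachable a b
  reachable_mid : (Z.within (insert b (insert c B)) ∅).Reachable b c
  reachable_right : (Z.within (insert c (insert a D)) ∅).Reachable c a

/-- Two vertices in one layer, the third in another: each neighbour `v` of `y` gives the
`x`-`y`-path through `v` in the common layer, continued along the column of `v` over one arc of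
the cycle to a fan centred at the third vertex. The other arc provides one more subgraph. -/
theorem hasPacking_boxProd_of_two_in_row [Finite V] {a d c : C} {A B D : Set C}
    (hA : Z.IsArcs a d c A B D) (had : a ≠ d) (hac : a ≠ c) (hdc : d ≠ c) {x y z : V}
    (hxy : x ≠ y) (hQ : Q.VertexConn m) (hm : 0 < m) (hdeg : Nat.card (Q.neighborSet y) = m) :
    (Z □ Q).HasPacking {(a, x), (a, y), (d, z)} (m + 1) := by
  classical
  have := Fintype.ofFinite V
  let N : Finset V := Q.neighborFinset y
  have hN : ∀ v, v ∈ N ↔ Q.Adj y v := fun v => mem_neighborFinset _ _ _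
  have hNc : N.card = m := by
    rw [← hdeg, Nat.card_eq_fintype_card, card_neighborSet_eq_degree]
    rfl
  obtain ⟨P, hP, hPd⟩ := hQ.exists_paths hxy hN hNc.le
  obtain ⟨R, hR, hRd⟩ := hQ.exists_fan z (A := N) ((Finset.card_le_card
    (Finset.erase_subset _ _)).trans hNc.le)
  set S : Set (C × V) := {(a, x), (a, y), (d, z)} with hS
  have memS : ∀ s p, (s, p) ∈ S ↔ (s = a ∧ (p = x ∨ p = y)) ∨ (s = d ∧ p = z) := by
    intro s p
    simp only [hS, Set.mem_insert_iff, Set.mem_singleton_iff, Prod.mk.injEq]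
    tauto
  let W : Option {v // v ∈ N} → Set (C × V) := fun i => i.elim
    {q | (q.1 ∈ B ∨ q.1 ∈ D ∨ q.1 = c) ∨ q ∈ S}
    fun v => {q | (q.1 = a ∧ q.2 ∈ P v) ∨ (q.1 ∈ A ∧ q.2 = v) ∨ (q.1 = d ∧ q.2 ∈ R v) ∨
      q = (a, y)}
  -- an edge between two of the three vertices is left to the subgraph of the neighbour `x` of `y`,
  -- which needs it
  let E : Option {v // v ∈ N} → Set (C × V) := fun i => i.elim S
    fun v => if v.1 = x then ∅ else S
  have hpack : (Z □ Q).IsPacking S fun i => (Z □ Q).within (W i) (E i) := by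
    refine isPacking_within (x := (a, x)) ?_ ?_ ?_
    · rintro (_ | ⟨v, hv⟩)
      · have colD : ∀ u, (a, u) ∈ S →
            ((Z □ Q).within (W none) (E none)).Reachable (c, u) (a, u) := by
          intro u hu
          refine within.reachable_column hA.reachable_right ?_ ?_
          · rintro s (rfl | rfl | hs)
            · exact Or.inl (Or.inr (Or.inr rfl))
            · exact Or.inr hu
            · exact Or.inl (Or.inr (Or.inl hs))
          · have key : ∀ s ∈ insert c (insert a D), (s, u) ∈ S → s = a := by
              rintro s hs h
              rcases (memS _ _).1 h with h | ⟨rfl, -⟩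
              · exact h.1
              · rcases hs with h | h | h
                · exact absurd h hdc
                · exact absurd h had.symm
                · exact absurd rfl (hA.ne _ (Or.inr (Or.inr h))).2.1
            intro s hs t ht hst h h'
            exact hst.ne ((key s hs h).trans (key t ht h').symm)
        have colB : ((Z □ Q).within (W none) (E none)).Reachable (d, z) (c, z) := by
          refine within.reachable_column hA.reachable_mid ?_ ?_
          · rintro s (rfl | rfl | hs)
            · exact Or.inr ((memS _ _).2 (Or.inr ⟨rfl, rfl⟩))
            · exact Or.inl (Or.inr (Or.inr rfl))
            · exact Or.inl (Or.inl hs)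
          · have key : ∀ s ∈ insert d (insert c B), (s, z) ∈ S → s = d := by
              rintro s hs h
              rcases (memS _ _).1 h with ⟨rfl, -⟩ | h
              · rcases hs with h | h | h
                · exact absurd h had
                · exact absurd h hac
                · exact absurd rfl (hA.ne _ (Or.inr (Or.inl h))).1
              · exact h.1
            intro s hs t ht hst h h'
            exact hst.ne ((key s hs h).trans (key t ht h').symm)
        have row : ∀ p q, ((Z □ Q).within (W none) (E none)).Reachable (c, p) (c, q) := by
          intro p q
          refine within.reachable_row (D := Set.univ)
            (by rw [within_univ]; exact hQ.preconnected hm p q) ?_ ?_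
          · exact fun _ _ => Or.inl (Or.inr (Or.inr rfl))
          · intro p _ q _ _ h
            rcases (memS _ _).1 h with h | h
            · exact absurd h.1 hac.symm
            · exact absurd h.1 hdc.symm
        have hx : (a, x) ∈ S := (memS _ _).2 (Or.inl ⟨rfl, Or.inl rfl⟩)
        have hy : (a, y) ∈ S := (memS _ _).2 (Or.inl ⟨rfl, Or.inr rfl⟩)
        rintro _ (rfl | rfl | rfl)
        · exact Reachable.refl _
        · exact (colD x hx).symm.trans ((row x y).trans (colD y hy))
        · exact (colD x hx).symm.trans ((row x z).trans colB.symm)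
      · obtain ⟨hvP, hyP, hPr⟩ := hP v hv
        obtain ⟨hvR, hRr⟩ := hR v hv
        have hvy : v ≠ y := fun h => Q.loopless.irrefl y (h ▸ (hN v).1 hv)
        have memE : ∀ s p, (s, p) ∈ E (some ⟨v, hv⟩) → v ≠ x ∧ (s, p) ∈ S := by
          intro s p h
          simp only [E, Option.elim_some] at h
          split_ifs at h with hvx
          · exact absurd h (Set.notMem_empty _)
          · exact ⟨hvx, h⟩
        have r1 : ((Z □ Q).within (W (some ⟨v, hv⟩)) (E (some ⟨v, hv⟩))).Reachable
            (a, x) (a, v) := by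
          refine within.reachable_row hPr (fun p hp => Or.inl ⟨rfl, hp⟩) ?_
          have key : ∀ p ∈ P v, (a, p) ∈ E (some ⟨v, hv⟩) → p = x := by
            intro p hp h
            rcases (memS _ _).1 (memE _ _ h).2 with ⟨-, h | h⟩ | h
            · exact h
            · exact absurd (h ▸ hp) hyP
            · exact absurd h.1 had
          intro p hp q hq hpq h h'
          exact hpq.ne ((key p hp h).trans (key q hq h').symm)
        have r2 : ((Z □ Q).within (W (some ⟨v, hv⟩)) (E (some ⟨v, hv⟩))).Reachable
            (a, v) (a, y) := by
          refine Adj.reachable ⟨boxProd_adj_right.2 ((hN v).1 hv).symm, Or.inl ⟨rfl, hvP⟩,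
            Or.inr (Or.inr (Or.inr rfl)), fun h => ?_⟩
          obtain ⟨hvx, h⟩ := memE _ _ h.1
          rcases (memS _ _).1 h with ⟨-, h | h⟩ | h
          · exact hvx h
          · exact hvy h
          · exact had h.1
        have r3 : ((Z □ Q).within (W (some ⟨v, hv⟩)) (E (some ⟨v, hv⟩))).Reachable
            (a, v) (d, v) := by
          refine within.reachable_column hA.reachable_left ?_ ?_
          · rintro s (rfl | rfl | hs)
            · exact Or.inl ⟨rfl, hvP⟩
            · exact Or.inr (Or.inr (Or.inl ⟨rfl, hvR⟩))
            · exact Or.inr (Or.inl ⟨hs, rfl⟩)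
          · have key : ∀ s, (s, v) ∈ E (some ⟨v, hv⟩) → s = d := by
              intro s h
              obtain ⟨hvx, h⟩ := memE _ _ h
              rcases (memS _ _).1 h with ⟨-, h | h⟩ | h
              · exact absurd h hvx
              · exact absurd h hvy
              · exact h.1
            intro s _ t _ hst h h'
            exact hst.ne ((key s h).trans (key t h').symm)
        have r4 : ((Z □ Q).within (W (some ⟨v, hv⟩)) (E (some ⟨v, hv⟩))).Reachable
            (d, z) (d, v) := by
          refine within.reachable_row hRr (fun p hp => Or.inr (Or.inr (Or.inl ⟨rfl, hp⟩))) ?_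
          have key : ∀ p, (d, p) ∈ E (some ⟨v, hv⟩) → p = z := by
            intro p h
            rcases (memS _ _).1 (memE _ _ h).2 with h | h
            · exact absurd h.1 had.symm
            · exact h.2
          intro p _ q _ hpq h h'
          exact hpq.ne ((key p h).trans (key q h').symm)
        rintro _ (rfl | rfl | rfl)
        · exact Reachable.refl _
        · exact r1.trans r2
        · exact r1.trans (r3.trans r4.symm)
    · have hnone : ∀ v, ∀ q, q ∈ W none → q ∈ W (some v) → q ∈ S := by
        rintro v ⟨s, p⟩ (h | h) h'
        · exfalso
          have h1 := hA.disjoint s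
          have h2 := hA.ne s
          rcases h' with ⟨rfl, -⟩ | ⟨hs, -⟩ | ⟨rfl, -⟩ | h'
          · rcases h with h | h | h
            · exact (h2 (Or.inr (Or.inl h))).1 rfl
            · exact (h2 (Or.inr (Or.inr h))).1 rfl
            · exact hac h
          · rcases h with h | h | h
            · exact h1.1 hs h
            · exact h1.2.2 hs h
            · exact (h2 (Or.inl hs)).2.2 h
          · rcases h with h | h | h
            · exact (h2 (Or.inr (Or.inl h))).2.1 rfl
            · exact (h2 (Or.inr (Or.inr h))).2.1 rfl
            · exact hdc h
          · obtain rfl : s = a := congrArg Prod.fst h'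
            rcases h with h | h | h
            · exact (h2 (Or.inr (Or.inl h))).1 rfl
            · exact (h2 (Or.inr (Or.inr h))).1 rfl
            · exact hac h
        · exact h
      rintro (_ | v) (_ | w) hij ⟨s, p⟩ h h'
      · exact absurd rfl hij
      · exact hnone w _ h h'
      · exact hnone v _ h' h
      · have hvw : v.1 ≠ w.1 := fun h => hij (congrArg some (Subtype.ext h))
        have hsA : s ∈ A → s ≠ a ∧ s ≠ d := fun h =>
          ⟨(hA.ne s (Or.inl h)).1, (hA.ne s (Or.inl h)).2.1⟩
        rw [memS]
        rcases h with ⟨hs, h⟩ | ⟨hs, h⟩ | ⟨hs, h⟩ | h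
        · rcases h' with ⟨hs', h'⟩ | ⟨hs', h'⟩ | ⟨hs', h'⟩ | h'
          · exact Or.inl ⟨hs, Or.inl (hPd _ v.2 _ w.2 hvw p h h')⟩
          · exact absurd hs (hsA hs').1
          · exact absurd (hs.symm.trans hs') had
          · exact Or.inl ⟨hs, Or.inr (congrArg Prod.snd h')⟩
        · rcases h' with ⟨hs', h'⟩ | ⟨hs', h'⟩ | ⟨hs', h'⟩ | h'
          · exact absurd hs' (hsA hs).1
          · exact absurd (h.symm.trans h') hvw
          · exact absurd hs' (hsA hs).2
          · exact absurd (congrArg Prod.fst h') (hsA hs).1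
        · rcases h' with ⟨hs', h'⟩ | ⟨hs', h'⟩ | ⟨hs', h'⟩ | h'
          · exact absurd (hs'.symm.trans hs) had
          · exact absurd hs (hsA hs').2
          · exact Or.inr ⟨hs, hRd _ v.2 _ w.2 hvw p h h'⟩
          · exact absurd ((congrArg Prod.fst h').symm.trans hs) had
        · exact Or.inl ⟨congrArg Prod.fst h, Or.inr (congrArg Prod.snd h)⟩
    · rintro (_ | v) (_ | w) hij p hp q hq -
      · exact absurd rfl hij
      · exact Or.inl ⟨hp, hq⟩
      · exact Or.inr ⟨hp, hq⟩
      · by_cases hv : v.1 = x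
        · have hw : w.1 ≠ x := fun h => hij (congrArg some (Subtype.ext (hv.trans h.symm)))
          right
          simpa [E, hw] using ⟨hp, hq⟩
        · left
          simpa [E, hv] using ⟨hp, hq⟩
  refine hpack.hasPacking ?_
  rw [Nat.card_eq_fintype_card, Fintype.card_option, Fintype.card_coe, hNc]

/-- All three vertices in distinct layers and distinct columns. A set `T` of `m + 1` columns
containing those of the three vertices indexes the subgraphs; in the layer of each of the three
there is a fan from it to the other columns of `T`. A column other than these three just joins
the three fans. The subgraph indexed by `x` consists of the fan paths from `(a, x)` to the columns
of `y` and `z`, followed along these columns to `(b, y)` and `(c, z)`, and similarly for `y` and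
`z`. So over each arc the columns are permuted by a transposition. -/
theorem hasPacking_boxProd_of_distinct [Finite V] {a b c : C} {A B D : Set C}
    (hA : Z.IsArcs a b c A B D) (hab : a ≠ b) (hac : a ≠ c) (hbc : b ≠ c) {x y z : V}
    (hxy : x ≠ y) (hxz : x ≠ z) (hyz : y ≠ z) (hQ : Q.VertexConn m) (hm : 2 ≤ m)
    (hcard : m < Nat.card V) :
    (Z □ Q).HasPacking {(a, x), (b, y), (c, z)} (m + 1) := by
  classical
  have := Fintype.ofFinite V
  have h3 : ({x, y, z} : Finset V).card = 3 := Finset.card_eq_three.2 ⟨x, y, z, hxy, hxz, hyz, rfl⟩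
  obtain ⟨T, hT, hTc⟩ := Finset.exists_superset_card_eq (s := {x, y, z}) (n := m + 1)
    (by omega) (by rwa [Nat.card_eq_fintype_card] at hcard)
  have hxT : x ∈ T := hT (by simp)
  have hyT : y ∈ T := hT (by simp)
  have hzT : z ∈ T := hT (by simp)
  have fan : ∀ o ∈ T, ∃ D : V → Set V, (∀ v ∈ T, v ∈ D v ∧ (Q.within (D v) ∅).Reachable o v) ∧
      ∀ v ∈ T, ∀ w ∈ T, v ≠ w → ∀ a ∈ D v, a ∈ D w → a = o := fun o ho =>
    hQ.exists_fan o (by rw [Finset.card_erase_of_mem ho]; omega)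
  obtain ⟨P, hP, hPd⟩ := fan x hxT
  obtain ⟨P', hP', hPd'⟩ := fan y hyT
  obtain ⟨P'', hP'', hPd''⟩ := fan z hzT
  -- `φ o v` is the index of the subgraph using the path to `v` of the fan centred at `o`
  let φ : V → V → V := fun o v => if v = x ∨ v = y ∨ v = z then o else v
  set S : Set (C × V) := {(a, x), (b, y), (c, z)} with hS
  have memS : ∀ s p, (s, p) ∈ S ↔ (s = a ∧ p = x) ∨ (s = b ∧ p = y) ∨ (s = c ∧ p = z) := by
    intro s p
    simp only [hS, Set.mem_insert_iff, Set.mem_singleton_iff, Prod.mk.injEq]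
  let W : {v // v ∈ T} → Set (C × V) := fun i =>
    {q | q ∈ S ∨ (q.1 = a ∧ ∃ v ∈ T, φ x v = i ∧ q.2 ∈ P v) ∨
      (q.1 = b ∧ ∃ v ∈ T, φ y v = i ∧ q.2 ∈ P' v) ∨
      (q.1 = c ∧ ∃ v ∈ T, φ z v = i ∧ q.2 ∈ P'' v) ∨
      (q.1 ∈ A ∧ q.2 = Equiv.swap x y i) ∨
      (q.1 ∈ B ∧ q.2 = Equiv.swap y z i) ∨
      (q.1 ∈ D ∧ q.2 = Equiv.swap x z i)}
  have hpack : (Z □ Q).IsPacking S fun i => (Z □ Q).within (W i) ∅ := by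
    refine isPacking_within (x := (a, x)) ?_ ?_ ?_
    · intro i
      have row : ∀ v ∈ T, φ x v = i → ((Z □ Q).within (W i) ∅).Reachable (a, x) (a, v) :=
        fun v hv hi => within.reachable_row (hP v hv).2
          (fun p hp => Or.inr (Or.inl ⟨rfl, v, hv, hi, hp⟩)) (fun _ _ _ _ _ h => absurd h id)
      have row' : ∀ v ∈ T, φ y v = i → ((Z □ Q).within (W i) ∅).Reachable (b, y) (b, v) :=
        fun v hv hi => within.reachable_row (hP' v hv).2
          (fun p hp => Or.inr (Or.inr (Or.inl ⟨rfl, v, hv, hi, hp⟩)))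
          (fun _ _ _ _ _ h => absurd h id)
      have row'' : ∀ v ∈ T, φ z v = i → ((Z □ Q).within (W i) ∅).Reachable (c, z) (c, v) :=
        fun v hv hi => within.reachable_row (hP'' v hv).2
          (fun p hp => Or.inr (Or.inr (Or.inr (Or.inl ⟨rfl, v, hv, hi, hp⟩))))
          (fun _ _ _ _ _ h => absurd h id)
      have mem : ∀ v ∈ T, φ x v = i → (a, v) ∈ W i := fun v hv hi =>
        Or.inr (Or.inl ⟨rfl, v, hv, hi, (hP v hv).1⟩)
      have mem' : ∀ v ∈ T, φ y v = i → (b, v) ∈ W i := fun v hv hi =>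
        Or.inr (Or.inr (Or.inl ⟨rfl, v, hv, hi, (hP' v hv).1⟩))
      have mem'' : ∀ v ∈ T, φ z v = i → (c, v) ∈ W i := fun v hv hi =>
        Or.inr (Or.inr (Or.inr (Or.inl ⟨rfl, v, hv, hi, (hP'' v hv).1⟩)))
      have memx : (a, x) ∈ W i := Or.inl (by simp [hS])
      have memy : (b, y) ∈ W i := Or.inl (by simp [hS])
      have memz : (c, z) ∈ W i := Or.inl (by simp [hS])
      have col : ∀ p, p = Equiv.swap x y i → (a, p) ∈ W i → (b, p) ∈ W i →
          ((Z □ Q).within (W i) ∅).Reachable (a, p) (b, p) := by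
        intro p hp h1 h2
        refine within.reachable_column hA.reachable_left ?_ (fun _ _ _ _ _ h => absurd h id)
        rintro s (rfl | rfl | hs)
        · exact h1
        · exact h2
        · exact Or.inr (Or.inr (Or.inr (Or.inr (Or.inl ⟨hs, hp⟩))))
      have col' : ∀ p, p = Equiv.swap y z i → (b, p) ∈ W i → (c, p) ∈ W i →
          ((Z □ Q).within (W i) ∅).Reachable (b, p) (c, p) := by
        intro p hp h1 h2
        refine within.reachable_column hA.reachable_mid ?_ (fun _ _ _ _ _ h => absurd h id)
        rintro s (rfl | rfl | hs)
        · exact h1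
        · exact h2
        · exact Or.inr (Or.inr (Or.inr (Or.inr (Or.inr (Or.inl ⟨hs, hp⟩)))))
      have col'' : ∀ p, p = Equiv.swap x z i → (c, p) ∈ W i → (a, p) ∈ W i →
          ((Z □ Q).within (W i) ∅).Reachable (c, p) (a, p) := by
        intro p hp h1 h2
        refine within.reachable_column hA.reachable_right ?_ (fun _ _ _ _ _ h => absurd h id)
        rintro s (rfl | rfl | hs)
        · exact h1
        · exact h2
        · exact Or.inr (Or.inr (Or.inr (Or.inr (Or.inr (Or.inr ⟨hs, hp⟩)))))
      have φx : ∀ o, φ o x = o := fun o => by simp [φ]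
      have φy : ∀ o, φ o y = o := fun o => by simp [φ]
      have φz : ∀ o, φ o z = o := fun o => by simp [φ]
      suffices h : ((Z □ Q).within (W i) ∅).Reachable (a, x) (b, y) ∧
          ((Z □ Q).within (W i) ∅).Reachable (a, x) (c, z) by
        rintro _ (rfl | rfl | rfl)
        exacts [Reachable.refl _, h.1, h.2]
      obtain ⟨i, hi⟩ := i
      by_cases hix : i = x
      · subst hix
        exact ⟨(row y hyT (φy _)).trans (col y (by simp) (mem y hyT (φy _)) memy),
          (row z hzT (φz _)).trans (col'' z (by simp) memz (mem z hzT (φz _))).symm⟩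
      by_cases hiy : i = y
      · subst hiy
        have h := (col x (by simp) memx (mem' x hxT (φx _))).trans (row' x hxT (φx _)).symm
        exact ⟨h, h.trans ((row' z hzT (φz _)).trans
          (col' z (by simp) (mem' z hzT (φz _)) memz))⟩
      by_cases hiz : i = z
      · subst hiz
        have h := (col'' x (by simp) (mem'' x hxT (φx _)) memx).symm.trans
          (row'' x hxT (φx _)).symm
        exact ⟨h.trans ((row'' y hyT (φy _)).trans
          (col' y (by simp) memy (mem'' y hyT (φy _))).symm), h⟩
      have φi : ∀ o, φ o i = i := fun o => by simp [φ, hix, hiy, hiz]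
      have h := (row i hi (φi _)).trans (col i (Equiv.swap_apply_of_ne_of_ne hix hiy).symm
        (mem i hi (φi _)) (mem' i hi (φi _)))
      exact ⟨h.trans (row' i hi (φi _)).symm, h.trans
        ((col' i (Equiv.swap_apply_of_ne_of_ne hiy hiz).symm (mem' i hi (φi _))
          (mem'' i hi (φi _))).trans (row'' i hi (φi _)).symm)⟩
    · rintro ⟨i, hi⟩ ⟨j, hj⟩ hij ⟨s, p⟩ h h'
      have hij : i ≠ j := fun h => hij (Subtype.ext h)
      have φne : ∀ o v w, φ o v = i → φ o w = j → v ≠ w := by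
        rintro o v w h h' rfl
        exact hij (h.symm.trans h')
      have swapne : ∀ u v, p = Equiv.swap u v i → p = Equiv.swap u v j → False := fun u v h h' =>
        hij ((Equiv.swap u v).injective (h.symm.trans h'))
      have h1 := hA.disjoint s
      have h2 := hA.ne s
      have la : s = a → ∀ k, (s, p) ∈ W k → p = x ∨ ∃ v ∈ T, φ x v = k ∧ p ∈ P v := by
        rintro rfl k hk
        simp only [ne_eq, not_true, false_and, imp_false, not_or] at h2
        simpa [W, memS, h2, hab, hac] using hk
      have lb : s = b → ∀ k, (s, p) ∈ W k → p = y ∨ ∃ v ∈ T, φ y v = k ∧ p ∈ P' v := by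
        rintro rfl k hk
        simp only [ne_eq, not_true, false_and, and_false, imp_false, not_or] at h2
        simpa [W, memS, h2, hab.symm, hbc] using hk
      have lc : s = c → ∀ k, (s, p) ∈ W k → p = z ∨ ∃ v ∈ T, φ z v = k ∧ p ∈ P'' v := by
        rintro rfl k hk
        simp only [ne_eq, not_true, and_false, imp_false, not_or] at h2
        simpa [W, memS, h2, hac.symm, hbc.symm] using hk
      have lA : s ∈ A → ∀ k, (s, p) ∈ W k → p = Equiv.swap x y k := by
        intro hs k hk
        simpa [W, memS, h2 (Or.inl hs), h1.1 hs, h1.2.2 hs, hs] using hk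
      have lB : s ∈ B → ∀ k, (s, p) ∈ W k → p = Equiv.swap y z k := by
        intro hs k hk
        simpa [W, memS, h2 (Or.inr (Or.inl hs)), show s ∉ A from fun h => h1.1 h hs, h1.2.1 hs,
          hs] using hk
      have lD : s ∈ D → ∀ k, (s, p) ∈ W k → p = Equiv.swap x z k := by
        intro hs k hk
        simpa [W, memS, h2 (Or.inr (Or.inr hs)), show s ∉ A from fun h => h1.2.2 h hs,
          show s ∉ B from fun h => h1.2.1 h hs, hs] using hk
      rcases id h with hS | ⟨hs, -⟩ | ⟨hs, -⟩ | ⟨hs, -⟩ | ⟨hs, -⟩ | ⟨hs, -⟩ | ⟨hs, -⟩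
      · exact hS
      · refine (memS _ _).2 (Or.inl ⟨hs, ?_⟩)
        obtain hp | ⟨v, hv, hφ, hp⟩ := la hs _ h
        · exact hp
        obtain hp' | ⟨w, hw, hφ', hp'⟩ := la hs _ h'
        · exact hp'
        exact hPd v hv w hw (φne _ _ _ hφ hφ') p hp hp'
      · refine (memS _ _).2 (Or.inr (Or.inl ⟨hs, ?_⟩))
        obtain hp | ⟨v, hv, hφ, hp⟩ := lb hs _ h
        · exact hp
        obtain hp' | ⟨w, hw, hφ', hp'⟩ := lb hs _ h'
        · exact hp'
        exact hPd' v hv w hw (φne _ _ _ hφ hφ') p hp hp'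
      · refine (memS _ _).2 (Or.inr (Or.inr ⟨hs, ?_⟩))
        obtain hp | ⟨v, hv, hφ, hp⟩ := lc hs _ h
        · exact hp
        obtain hp' | ⟨w, hw, hφ', hp'⟩ := lc hs _ h'
        · exact hp'
        exact hPd'' v hv w hw (φne _ _ _ hφ hφ') p hp hp'
      · exact (swapne _ _ (lA hs _ h) (lA hs _ h')).elim
      · exact (swapne _ _ (lB hs _ h) (lB hs _ h')).elim
      · exact (swapne _ _ (lD hs _ h) (lD hs _ h')).elim
    · -- the three vertices are pairwise nonadjacent
      rintro i j - ⟨s, p⟩ hp ⟨t, q⟩ hq h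
      rw [boxProd_adj] at h
      rw [memS] at hp hq
      exfalso
      rcases hp with ⟨rfl, rfl⟩ | ⟨rfl, rfl⟩ | ⟨rfl, rfl⟩ <;>
        rcases hq with ⟨rfl, rfl⟩ | ⟨rfl, rfl⟩ | ⟨rfl, rfl⟩ <;>
        rcases h with ⟨h, h'⟩ | ⟨h, h'⟩ <;>
        first
        | exact h.ne rfl
        | exact absurd h' ‹_›
        | exact absurd h'.symm ‹_›
  refine hpack.hasPacking ?_
  rw [Nat.card_eq_fintype_card, Fintype.card_coe, hTc]

end Distribution

/-! ### The cycle on the residues modulo `k` -/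

section Cycle

/-- The cycle on the residues modulo `k`. -/
def residueCycle (k : ℕ) : SimpleGraph (ZMod k) := circulantGraph {1}

theorem residueCycle_adj {k : ℕ} {a b : ZMod k} :
    (residueCycle k).Adj a b ↔ a ≠ b ∧ (a = b + 1 ∨ a = b - 1) := by
  simp only [residueCycle, circulantGraph_adj, Set.mem_singleton_iff]
  refine and_congr_right fun _ => or_congr sub_eq_iff_eq_add' ?_
  rw [sub_eq_iff_eq_add', eq_sub_iff_add_eq]
  exact eq_comm

variable {k : ℕ}

theorem one_ne_zero_zmod (hk : 3 ≤ k) : (1 : ZMod k) ≠ 0 := by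
  have : Fact (1 < k) := ⟨by omega⟩
  exact one_ne_zero

theorem card_neighborSet_residueCycle (hk : 3 ≤ k) (s : ZMod k) :
    Nat.card ((residueCycle k).neighborSet s) = 2 := by
  have h1 := one_ne_zero_zmod hk
  have h2 : ((2 : ℕ) : ZMod k) ≠ 0 := by
    rw [Ne, ZMod.natCast_eq_zero_iff]
    exact fun h => by have := Nat.le_of_dvd (by norm_num) h; omega
  have : (residueCycle k).neighborSet s = {s + 1, s - 1} := by
    ext t
    simp only [mem_neighborSet, residueCycle_adj, Set.mem_insert_iff, Set.mem_singleton_iff]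
    constructor
    · rintro ⟨-, rfl | rfl⟩ <;> simp
    · rintro (rfl | rfl) <;> simp [h1, sub_eq_add_neg]
  rw [this, Nat.card_coe_set_eq, Set.ncard_pair]
  intro h
  apply h2
  push_cast
  linear_combination h

theorem residueCycle.reachable_natCast (hk : 3 ≤ k) {W : Set (ZMod k)} {i j : ℕ} (hij : i ≤ j)
    (hW : ∀ t : ℕ, i ≤ t → t ≤ j → (t : ZMod k) ∈ W) :
    ((residueCycle k).within W ∅).Reachable (i : ZMod k) (j : ZMod k) := by
  induction j, hij using Nat.le_induction with
  | base => exact Reachable.refl _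
  | succ j hj ih =>
    refine (ih fun t h1 h2 => hW t h1 (by omega)).trans (Adj.reachable
      ⟨residueCycle_adj.2 ⟨?_, Or.inr ?_⟩, hW j hj (by omega), hW _ (by omega) le_rfl, by simp⟩)
    · simp [one_ne_zero_zmod hk]
    · simp

theorem IsArcs.rotate {C : Type*} {Z : SimpleGraph C} {a b c : C} {A B D : Set C}
    (h : Z.IsArcs a b c A B D) : Z.IsArcs b c a B D A where
  disjoint s := by have := h.disjoint s; tauto
  ne s := by have := h.ne s; tauto
  reachable_left := h.reachable_mid
  reachable_mid := h.reachable_right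
  reachable_right := h.reachable_left

theorem IsArcs.swap {C : Type*} {Z : SimpleGraph C} {a b c : C} {A B D : Set C}
    (h : Z.IsArcs a b c A B D) : Z.IsArcs b a c A D B where
  disjoint s := by have := h.disjoint s; tauto
  ne s := by have := h.ne s; tauto
  reachable_left := by rw [Set.insert_comm]; exact h.reachable_left.symm
  reachable_mid := by rw [Set.insert_comm]; exact h.reachable_right.symm
  reachable_right := by rw [Set.insert_comm]; exact h.reachable_mid.symm

theorem exists_isArcs_of_val_lt (hk : 3 ≤ k) {a b c : ZMod k} (hab : a.val < b.val)
    (hbc : b.val < c.val) : ∃ A B D, (residueCycle k).IsArcs a b c A B D := by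
  have : NeZero k := ⟨by omega⟩
  have hc := ZMod.val_lt c
  refine ⟨{s | a.val < s.val ∧ s.val < b.val}, {s | b.val < s.val ∧ s.val < c.val},
    {s | c.val < s.val ∨ s.val < a.val}, ?_, ?_, ?_, ?_, ?_⟩
  · intro s
    refine ⟨fun h h' => ?_, fun h h' => ?_, fun h h' => ?_⟩
    · exact absurd h.2 h'.1.not_gt
    · rcases h' with h' | h'
      · exact absurd h.2 h'.not_gt
      · exact absurd (hab.trans h.1) h'.not_gt
    · rcases h' with h' | h'
      · exact absurd (h.2.trans hbc) h'.not_gt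
      · exact absurd h.1 h'.not_gt
  · rintro s h
    have : (a.val < s.val ∧ s.val < b.val) ∨ (b.val < s.val ∧ s.val < c.val) ∨
      (c.val < s.val ∨ s.val < a.val) := h
    refine ⟨?_, ?_, ?_⟩ <;> rintro rfl <;> omega
  · have := residueCycle.reachable_natCast hk
      (W := insert a (insert b {s : ZMod k | a.val < s.val ∧ s.val < b.val})) hab.le (by
        intro t h1 h2
        rcases h1.eq_or_lt with rfl | h1
        · left; exact ZMod.natCast_zmod_val a
        rcases h2.eq_or_lt with rfl | h2
        · right; left; exact ZMod.natCast_zmod_val b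
        right; right
        change _ < _ ∧ _ < _
        rw [ZMod.val_cast_of_lt (by omega)]
        exact ⟨h1, h2⟩)
    simpa only [ZMod.natCast_zmod_val] using this
  · have := residueCycle.reachable_natCast hk
      (W := insert b (insert c {s : ZMod k | b.val < s.val ∧ s.val < c.val})) hbc.le (by
        intro t h1 h2
        rcases h1.eq_or_lt with rfl | h1
        · left; exact ZMod.natCast_zmod_val b
        rcases h2.eq_or_lt with rfl | h2
        · right; left; exact ZMod.natCast_zmod_val c
        right; right
        change _ < _ ∧ _ < _
        rw [ZMod.val_cast_of_lt (by omega)]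
        exact ⟨h1, h2⟩)
    simpa only [ZMod.natCast_zmod_val] using this
  · have := residueCycle.reachable_natCast hk (i := c.val) (j := k + a.val)
      (W := insert c (insert a {s : ZMod k | c.val < s.val ∨ s.val < a.val})) (by omega) (by
        intro t h1 h2
        rcases h1.eq_or_lt with rfl | h1
        · left; exact ZMod.natCast_zmod_val c
        rcases h2.eq_or_lt with rfl | h2
        · right; left; simp
        right; right
        change _ < _ ∨ _ < _
        rw [ZMod.val_natCast]
        by_cases ht : t < k
        · left; rwa [Nat.mod_eq_of_lt ht]
        · right
          rw [Nat.mod_eq_sub_mod (by omega), Nat.mod_eq_of_lt (by omega)]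
          omega)
    simpa only [Nat.cast_add, CharP.cast_eq_zero, zero_add, ZMod.natCast_zmod_val] using this

theorem exists_isArcs (hk : 3 ≤ k) {a b c : ZMod k} (hab : a ≠ b) (hac : a ≠ c) (hbc : b ≠ c) :
    ∃ A B D, (residueCycle k).IsArcs a b c A B D := by
  have : NeZero k := ⟨by omega⟩
  have inj := ZMod.val_injective k
  rcases (inj.ne hab).lt_or_gt with h1 | h1 <;> rcases (inj.ne hac).lt_or_gt with h2 | h2 <;>
    rcases (inj.ne hbc).lt_or_gt with h3 | h3
  · exact exists_isArcs_of_val_lt hk h1 h3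
  · obtain ⟨A, B, D, h⟩ := exists_isArcs_of_val_lt hk h2 h3
    exact ⟨_, _, _, h.rotate.rotate.swap⟩
  · omega
  · obtain ⟨A, B, D, h⟩ := exists_isArcs_of_val_lt hk h2 h1
    exact ⟨_, _, _, h.rotate⟩
  · obtain ⟨A, B, D, h⟩ := exists_isArcs_of_val_lt hk h1 h2
    exact ⟨_, _, _, h.swap⟩
  · omega
  · obtain ⟨A, B, D, h⟩ := exists_isArcs_of_val_lt hk h3 h2
    exact ⟨_, _, _, h.rotate.rotate⟩
  · obtain ⟨A, B, D, h⟩ := exists_isArcs_of_val_lt hk h3 h1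
    exact ⟨_, _, _, h.rotate.swap⟩

theorem exists_ne_ne_zmod (hk : 3 ≤ k) (a b : ZMod k) : ∃ c, a ≠ c ∧ b ≠ c := by
  have : NeZero k := ⟨by omega⟩
  obtain ⟨c, -, hc⟩ := Finset.exists_mem_notMem_of_card_lt_card
    (s := {a, b}) (t := (Finset.univ : Finset (ZMod k))) (by
      rw [Finset.card_univ, ZMod.card]
      exact Finset.card_le_two.trans_lt (by omega))
  simp only [Finset.mem_insert, Finset.mem_singleton, not_or] at hc
  exact ⟨c, Ne.symm hc.1, Ne.symm hc.2⟩

theorem vertexConn_residueCycle (hk : 3 ≤ k) : (residueCycle k).VertexConn 2 := by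
  intro F hF f hf a b ha hb hfa
  by_cases hab : a = b
  · exact hab ▸ hfa
  obtain ⟨c, hac, hbc, hFc⟩ : ∃ c, a ≠ c ∧ b ≠ c ∧ F ⊆ {c} := by
    obtain rfl | ⟨c, hc⟩ := F.eq_empty_or_nonempty
    · obtain ⟨c, h⟩ := exists_ne_ne_zmod hk a b
      exact ⟨c, h.1, h.2, by simp⟩
    · refine ⟨c, fun h => ha (h ▸ hc), fun h => hb (h ▸ hc), fun x hx => ?_⟩
      exact Finset.mem_singleton.2 (Finset.card_le_one.1 (by omega) x hx c hc)
  obtain ⟨A, B, D, h⟩ := exists_isArcs hk hab hac hbc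
  have hout : ∀ s ∈ insert a (insert b A), s ∉ F := by
    rintro s (rfl | rfl | hs) hsF
    · exact ha hsF
    · exact hb hsF
    · exact (h.ne s (Or.inl hs)).2.2 (Finset.mem_singleton.1 (hFc hsF))
  have hr := h.reachable_left
  rw [reachable_iff_reflTransGen] at hr
  have : ∀ s, Relation.ReflTransGen ((residueCycle k).within (insert a (insert b A)) ∅).Adj a s →
      f s := by
    intro s hs
    induction hs with
    | refl => exact hfa
    | tail _ hst ih => exact hf _ _ (hout _ hst.2.1) (hout _ hst.2.2.1) hst.1 ih
  exact this b hr

end Cycle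

/-! ### The `k`-ary `n`-cube -/

section Cube

variable {k n : ℕ}

/-- Separating the `j`-th letter exhibits the `k`-ary cube of dimension `n + 1` as the Cartesian
product of a cycle and the cube of dimension `n`. -/
def kAryCubeIso (k : ℕ) {n : ℕ} (j : Fin (n + 1)) :
    kAryCube k (n + 1) ≃g residueCycle k □ kAryCube k n where
  toEquiv := (Fin.insertNthEquiv (fun _ => ZMod k) j).symm
  map_rel_iff' := by
    intro u v
    change (residueCycle k □ kAryCube k n).Adj (u j, j.removeNth u) (v j, j.removeNth v) ↔
      (kAryCube k (n + 1)).Adj u v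
    rw [boxProd_adj]
    constructor
    · rintro (⟨h, hrest⟩ | ⟨⟨hne, i, hi, hrest⟩, hj⟩)
      · refine ⟨fun huv => h.ne (congrFun huv j), j, (residueCycle_adj.1 h).2, fun i hij => ?_⟩
        obtain ⟨i', rfl⟩ := Fin.exists_succAbove_eq hij
        exact congrFun hrest i'
      · refine ⟨fun huv => hne (congrArg (Fin.removeNth j) huv), j.succAbove i, hi, fun i' hi' => ?_⟩
        obtain rfl | ⟨i', rfl⟩ := Fin.eq_self_or_eq_succAbove j i'
        · exact hj
        · exact hrest i' fun h => hi' (h ▸ rfl)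
    · rintro ⟨hne, i, hi, hrest⟩
      obtain rfl | ⟨i, rfl⟩ := Fin.eq_self_or_eq_succAbove j i
      · refine Or.inl ⟨residueCycle_adj.2 ⟨fun h => hne (funext fun i' => ?_), hi⟩,
          funext fun i' => hrest _ (Fin.succAbove_ne i i')⟩
        by_cases h' : i' = i
        · rw [h']; exact h
        · exact hrest i' h'
      · have hj : u j = v j := hrest j (Fin.succAbove_ne j i).symm
        refine Or.inr ⟨⟨fun h => hne (funext fun i' => ?_), i, hi, fun i' hi' =>
          hrest _ fun h => hi' (Fin.succAbove_right_injective h)⟩, hj⟩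
        obtain rfl | ⟨i', rfl⟩ := Fin.eq_self_or_eq_succAbove j i'
        · exact hj
        · exact congrFun h i'

theorem kAryCubeIso_apply (j : Fin (n + 1)) (u : Fin (n + 1) → ZMod k) :
    kAryCubeIso k j u = (u j, j.removeNth u) := rfl

theorem removeNth_ne {j : Fin (n + 1)} {u v : Fin (n + 1) → ZMod k} (huv : u ≠ v)
    (hj : u j = v j) : j.removeNth u ≠ j.removeNth v := fun h =>
  huv ((kAryCubeIso k j).injective (Prod.ext hj h))

/-- The one-dimensional cube is a cycle. -/
def kAryCubeOneIso (k : ℕ) : kAryCube k 1 ≃g residueCycle k where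
  toEquiv := Equiv.funUnique (Fin 1) (ZMod k)
  map_rel_iff' := by
    intro u v
    change (residueCycle k).Adj (u 0) (v 0) ↔ _
    rw [residueCycle_adj]
    constructor
    · rintro ⟨hne, h⟩
      exact ⟨fun huv => hne (congrFun huv 0), 0, h, fun i hi => absurd (Subsingleton.elim i 0) hi⟩
    · rintro ⟨hne, i, h, -⟩
      obtain rfl := Subsingleton.elim i 0
      exact ⟨fun h => hne (funext fun i => by rw [Subsingleton.elim i 0, h]), h⟩

theorem card_neighborSet_kAryCube (hk : 3 ≤ k) (n : ℕ) (u : Fin n → ZMod k) :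
    Nat.card ((kAryCube k n).neighborSet u) = 2 * n := by
  have : NeZero k := ⟨by omega⟩
  induction n with
  | zero =>
    have : IsEmpty ((kAryCube k 0).neighborSet u) := ⟨fun ⟨_, _, i, _⟩ => i.elim0⟩
    simp
  | succ n ih =>
    rw [Nat.card_congr ((kAryCubeIso k 0).mapNeighborSet u), card_neighborSet_boxProd,
      card_neighborSet_residueCycle hk, ih]
    ring

theorem two_mul_add_two_le_pow (hk : 3 ≤ k) (hn : 2 ≤ n) : 2 * n + 2 ≤ k ^ n := by
  refine le_trans ?_ (Nat.pow_le_pow_left hk n)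
  induction n, hn using Nat.le_induction with
  | base => norm_num
  | succ n hn ih => rw [pow_succ]; omega

theorem two_mul_lt_card (hk : 3 ≤ k) (hn : 1 ≤ n) : 2 * n < Nat.card (Fin n → ZMod k) := by
  have : NeZero k := ⟨by omega⟩
  simp only [Nat.card_eq_fintype_card, Fintype.card_fun, ZMod.card, Fintype.card_fin]
  obtain rfl | hn := hn.eq_or_lt
  · simpa using Nat.lt_of_succ_le hk
  · have := two_mul_add_two_le_pow hk hn
    omega

theorem vertexConn_kAryCube (hk : 3 ≤ k) (hn : 1 ≤ n) : (kAryCube k n).VertexConn (2 * n) := by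
  have : NeZero k := ⟨by omega⟩
  induction n, hn using Nat.le_induction with
  | base => exact (vertexConn_residueCycle hk).of_iso (kAryCubeOneIso k).symm
  | succ n hn ih =>
    refine VertexConn.of_iso (kAryCubeIso k 0).symm
      ((vertexConn_residueCycle hk).boxProd (fun s => ?_) ih
        (Nat.mul_le_mul_left 2 hn) (two_mul_lt_card hk hn) ?_)
    · have h := card_neighborSet_residueCycle hk s
      rw [Nat.card_coe_set_eq, Set.ncard_eq_two] at h
      obtain ⟨t, t', hne, h⟩ := h
      refine ⟨t, t', hne, ?_, ?_⟩ <;> rw [← mem_neighborSet, h] <;> simp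
    · obtain rfl | hn := hn.eq_or_lt
      · exact Or.inl rfl
      · right
        simpa [Nat.card_eq_fintype_card] using two_mul_add_two_le_pow hk hn

theorem hasPacking_kAryCube_of_eq_of_ne (hk : 3 ≤ k) (hn : 1 ≤ n)
    {u v w : Fin (n + 1) → ZMod k} (huv : u ≠ v) {j : Fin (n + 1)} (hj : u j = v j)
    (hj' : u j ≠ w j) : (kAryCube k (n + 1)).HasPacking {u, v, w} (2 * n + 1) := by
  have : NeZero k := ⟨by omega⟩
  refine HasPacking.of_iso (kAryCubeIso k j) ?_
  simp only [Set.image_insert_eq, Set.image_singleton, kAryCubeIso_apply, ← hj]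
  obtain ⟨c, hac, hdc⟩ := exists_ne_ne_zmod hk (u j) (w j)
  obtain ⟨A, B, D, h⟩ := exists_isArcs hk hj' hac hdc
  exact hasPacking_boxProd_of_two_in_row h hj' hac hdc (removeNth_ne huv hj)
    (vertexConn_kAryCube hk hn) (by omega) (card_neighborSet_kAryCube hk n _)

/-- If three vertices agree in some coordinate, that coordinate is removed by induction;
if some coordinate takes exactly two values on them, or none takes fewer than three, then the
corresponding construction in the product with a cycle applies. -/
theorem hasPacking_kAryCube (hk : 3 ≤ k) (n : ℕ) {u v w : Fin (n + 1) → ZMod k} (huv : u ≠ v)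
    (huw : u ≠ w) (hvw : v ≠ w) : (kAryCube k (n + 1)).HasPacking {u, v, w} (2 * n + 1) := by
  have : NeZero k := ⟨by omega⟩
  induction n with
  | zero =>
    refine ⟨fun _ => kAryCube k 1, fun _ => le_rfl, fun _ a _ b _ =>
      (vertexConn_kAryCube hk le_rfl).preconnected (by norm_num) a b, fun i j hij => ?_,
      fun i j hij => ?_⟩ <;>
    exact absurd (Subsingleton.elim (α := Fin 1) i j) hij
  | succ n ih =>
    by_cases hall : ∃ j, u j = v j ∧ u j = w j
    · obtain ⟨j, hv, hw⟩ := hall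
      refine HasPacking.of_iso (kAryCubeIso k j) ?_
      have := (ih (removeNth_ne huv hv) (removeNth_ne huw hw)
        (removeNth_ne hvw (hv.symm.trans hw))).boxProd_row (Z := residueCycle k) (s := u j)
        ((vertexConn_kAryCube hk (by omega)).preconnected (by omega))
      rw [card_neighborSet_residueCycle hk, show 2 * n + 1 + 2 = 2 * (n + 1) + 1 by ring] at this
      simpa only [Set.image_insert_eq, Set.image_singleton, kAryCubeIso_apply, ← hv, ← hw]
        using this
    by_cases h1 : ∃ j, u j = v j
    · obtain ⟨j, hj⟩ := h1
      exact hasPacking_kAryCube_of_eq_of_ne hk (by omega) huv hj fun h => hall ⟨j, hj, h⟩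
    by_cases h2 : ∃ j, u j = w j
    · obtain ⟨j, hj⟩ := h2
      rw [Set.pair_comm v w]
      exact hasPacking_kAryCube_of_eq_of_ne hk (by omega) huw hj fun h => h1 ⟨j, h⟩
    by_cases h3 : ∃ j, v j = w j
    · obtain ⟨j, hj⟩ := h3
      rw [Set.insert_comm, Set.pair_comm u w]
      exact hasPacking_kAryCube_of_eq_of_ne hk (by omega) hvw hj fun h => h1 ⟨j, h.symm⟩
    push Not at h1 h2 h3
    obtain ⟨A, B, D, h⟩ := exists_isArcs hk (h1 0) (h2 0) (h3 0)
    refine HasPacking.of_iso (kAryCubeIso k 0) ?_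
    simp only [Set.image_insert_eq, Set.image_singleton, kAryCubeIso_apply]
    exact hasPacking_boxProd_of_distinct h (h1 0) (h2 0) (h3 0)
      (fun h => h1 _ (congrFun h 0)) (fun h => h2 _ (congrFun h 0)) (fun h => h3 _ (congrFun h 0))
      (vertexConn_kAryCube hk (by omega)) (by omega) (two_mul_lt_card hk (by omega))

theorem exists_adj_kAryCube (hk : 3 ≤ k) (n : ℕ) :
    ∃ u v w, (kAryCube k (n + 1)).Adj u v ∧ w ≠ u ∧ w ≠ v := by
  have h1 := one_ne_zero_zmod hk
  obtain ⟨c, hc, hc'⟩ := exists_ne_ne_zmod hk 0 1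
  refine ⟨fun _ => 0, Function.update (fun _ => 0) 0 1, Function.update (fun _ => 0) 0 c,
    ⟨fun h => h1 ?_, 0, Or.inr (by simp), fun i hi => by simp [hi]⟩, fun h => hc ?_, fun h => hc' ?_⟩
  · simpa using (congrFun h 0).symm
  · simpa using (congrFun h 0).symm
  · simpa using (congrFun h 0).symm

end Cube

end SimpleGraph

theorem corollary2 (k n : ℕ) (hk : 3 ≤ k) (hn : 1 ≤ n) :
    (kAryCube k n).generalizedConnectivity 3 = ((2 * n - 1 : ℕ) : ℕ∞) := by
  classical
  have : NeZero k := ⟨by omega⟩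
  obtain ⟨n, rfl⟩ := Nat.exists_eq_add_of_le' hn
  refine le_antisymm ?_ (le_iInf ?_)
  · obtain ⟨u, v, w, huv, hwu, hwv⟩ := SimpleGraph.exists_adj_kAryCube hk n
    refine (iInf_le _ ⟨{u, v, w}, Finset.card_eq_three.2
      ⟨u, v, w, huv.ne, hwu.symm, hwv.symm, rfl⟩⟩).trans ?_
    exact SimpleGraph.treeConnectivity_le_of_adj huv hwu hwv
      (SimpleGraph.card_neighborSet_kAryCube hk _ u).le
      (SimpleGraph.card_neighborSet_kAryCube hk _ v).le
  · rintro ⟨S, hS⟩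
    obtain ⟨u, v, w, huv, huw, hvw, rfl⟩ := Finset.card_eq_three.1 hS
    refine SimpleGraph.HasPacking.le_treeConnectivity ⟨u, by simp⟩ ?_
    have := SimpleGraph.hasPacking_kAryCube hk n huv huw hvw
    rw [show 2 * (n + 1) - 1 = 2 * n + 1 by omega]
    simpa using this
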